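/- Fix $n \in \mathbb{N}$ and non-zero vectors $x, y \in \mathbb{R}^n$. For $m \ge 1$ and non-zero $u, v \in \mathbb{R}^m$ write $\cos(u, v) = \frac{(u, v)}{\|u\|\,\|v\|}$, where $(\cdot,\cdot)$ is the dot product and $\|\cdot\|$ the Euclidean norm. For each $q \ge 1$ let $R = R^{(q)}$ be a random $q \times n$ matrix whose entries are i.i.d. normal random variables with mean $0$ and variance $1/q$. (Then $Rx$ and $Ry$ are almost surely non-zero; on the null event where one of them vanishes, $\cos(Rx, Ry)$ is set to $0$.) Then $$\sqrt{q}\,\bigl[\cos(Rx, Ry) - \cos(x, y)\bigr] \xrightarrow{\ d\ } \mathcal{N}\Bigl(0, \bigl(1 - \cos^2(x, y)\bigr)^2\Bigr) \qquad \text{as } q \to \infty,$$ where $\xrightarrow{d}$ denotes convergence in distribution and $\mathcal{N}(0,0)$ denotes the point mass at $0$ (the case $\cos(x,y) = \pm 1$). -/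

import Mathlib

open MeasureTheory ProbabilityTheory Filter
open scoped NNReal Matrix

/-- The cosine similarity `(x, y) / (‖x‖ ‖y‖)` of two vectors of `ℝᵐ` with the Euclidean norm. -/
noncomputable def cosineSimilarity {m : ℕ} (x y : EuclideanSpace ℝ (Fin m)) : ℝ :=
  inner ℝ x y / (‖x‖ * ‖y‖)

/-- The image `A x ∈ ℝ^q` of `x ∈ ℝⁿ` under a `q × n` matrix `A`. -/
noncomputable def projectVector {q n : ℕ} (A : Matrix (Fin q) (Fin n) ℝ)
    (x : EuclideanSpace ℝ (Fin n)) : EuclideanSpace ℝ (Fin q) :=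
  WithLp.toLp 2 (A *ᵥ x.ofLp)

/-- `R` is a random projection matrix: a random `q × n` matrix whose entries are independent
normal random variables with mean `0` and variance `1 / q`. -/
structure IsRandomProjection {Ω : Type*} [MeasurableSpace Ω] {q n : ℕ}
    (R : Ω → Matrix (Fin q) (Fin n) ℝ) (μ : Measure Ω) : Prop where
  hasLaw_entry : ∀ i j, HasLaw (fun ω => R ω i j) (gaussianReal 0 (1 / (q : ℝ≥0))) μ
  iIndepFun_entry : iIndepFun (fun (p : Fin q × Fin n) ω => R ω p.1 p.2) μ

open scoped Topology RealInnerProductSpace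

/-! Only the law of each matrix matters, so all of them may be built on one space from the rows of a
single i.i.d. sequence of standard Gaussian vectors `g`. The cosine ignores positive scaling, so the
`1/√q` disappears and `x, y` become unit vectors `u, w` with inner product `c`.

Let `A`, `B`, `C` be the sample averages of `⟪u,g⟫²`, `⟪w,g⟫²`, `⟪u,g⟫⟪w,g⟫`. The delta method, done
by an exact identity (`sqrt_mul_cosine_sub_eq`), writes the error as the average of the centred
score `cosineScore` over `√A √B`, plus a term quadratic in `A - B`. The law of large numbers gives
`A, B → 1`, the central limit theorem handles the score, and Slutsky's lemma combines them. The
score has variance `(1 - c²)²` by fourth moments (`variance_cosineScore`). The case `c = ±1` needs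
no separate argument. -/

lemma integral_pow_four_gaussianReal (v : ℝ≥0) :
    ∫ x, x ^ 4 ∂(gaussianReal 0 v) = 3 * (v : ℝ) ^ 2 := by
  have h : ∫ x, x ^ 4 ∂(gaussianReal 0 v)
      = iteratedDeriv 4 (mgf (fun x ↦ x) (gaussianReal 0 v)) 0 := by
    rw [iteratedDeriv_mgf_zero] <;> simp
  have he (t : ℝ) : HasDerivAt (fun t : ℝ ↦ Real.exp (v * t ^ 2 / 2))
      (v * t * Real.exp (v * t ^ 2 / 2)) t := by
    convert! (((hasDerivAt_pow 2 t).const_mul (v : ℝ)).div_const 2).exp using 1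
    simp; ring
  have h1 : deriv (fun t : ℝ ↦ Real.exp (v * t ^ 2 / 2))
      = fun t ↦ v * t * Real.exp (v * t ^ 2 / 2) := funext fun t ↦ (he t).deriv
  have h2 : deriv (fun t : ℝ ↦ v * t * Real.exp (v * t ^ 2 / 2))
      = fun t ↦ (v + v ^ 2 * t ^ 2) * Real.exp (v * t ^ 2 / 2) := funext fun t ↦ by
    refine ((((hasDerivAt_id t).const_mul (v : ℝ)).mul (he t)).congr_deriv ?_).deriv
    simp; ring
  have h3 : deriv (fun t : ℝ ↦ (v + v ^ 2 * t ^ 2) * Real.exp (v * t ^ 2 / 2))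
      = fun t ↦ (3 * v ^ 2 * t + v ^ 3 * t ^ 3) * Real.exp (v * t ^ 2 / 2) := funext fun t ↦ by
    refine (((((hasDerivAt_pow 2 t).const_mul ((v : ℝ) ^ 2)).const_add (v : ℝ)).mul
      (he t)).congr_deriv ?_).deriv
    simp; ring
  have h4 : deriv (fun t : ℝ ↦ (3 * v ^ 2 * t + v ^ 3 * t ^ 3) * Real.exp (v * t ^ 2 / 2)) 0
      = 3 * (v : ℝ) ^ 2 := by
    refine (((((hasDerivAt_id (0 : ℝ)).const_mul (3 * (v : ℝ) ^ 2)).add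
      ((hasDerivAt_pow 3 (0 : ℝ)).const_mul ((v : ℝ) ^ 3))).mul (he 0)).congr_deriv ?_).deriv
    simp
  rw [h, mgf_fun_id_gaussianReal]
  simp only [zero_mul, zero_add]
  rw [iteratedDeriv_succ, iteratedDeriv_succ, iteratedDeriv_succ, iteratedDeriv_one, h1, h2, h3, h4]

/-! ### Moments of the standard Gaussian and variance of the score -/

section StdGaussian

variable {E : Type*} [NormedAddCommGroup E] [InnerProductSpace ℝ E] [FiniteDimensional ℝ E]
  [MeasurableSpace E] [BorelSpace E]

lemma hasLaw_inner_stdGaussian (z : E) :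
    HasLaw (fun g : E ↦ ⟪z, g⟫) (gaussianReal 0 (‖z‖₊ ^ 2)) (stdGaussian E) where
  map_eq := by
    have h := IsGaussian.map_eq_gaussianReal (μ := stdGaussian E) (innerSL ℝ z)
    rw [variance_dual_stdGaussian, integral_strongDual_stdGaussian, innerSL_apply_norm] at h
    convert! h using 2
    ext; simp

lemma memLp_inner_stdGaussian (z : E) (p : ℝ≥0) :
    MemLp (fun g : E ↦ ⟪z, g⟫) p (stdGaussian E) := by
  have h := memLp_id_gaussianReal (μ := 0) (v := ‖z‖₊ ^ 2) p
  rw [← (hasLaw_inner_stdGaussian z).map_eq] at h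
  exact (memLp_map_measure_iff (f := fun g : E ↦ ⟪z, g⟫) (by fun_prop) (by fun_prop)).1 h

lemma integral_inner_sq_stdGaussian (z : E) :
    ∫ g, ⟪z, g⟫ ^ 2 ∂(stdGaussian E) = ‖z‖ ^ 2 := by
  have h := (hasLaw_inner_stdGaussian z).integral_comp (f := fun x : ℝ ↦ x ^ 2) (by fun_prop)
  simp only [Function.comp_def] at h
  rw [h]
  have hv := variance_fun_id_gaussianReal (μ := 0) (v := ‖z‖₊ ^ 2)
  rw [variance_eq_integral measurable_id'.aemeasurable] at hv
  simpa using hv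

lemma integral_inner_pow_four_stdGaussian (z : E) :
    ∫ g, ⟪z, g⟫ ^ 4 ∂(stdGaussian E) = 3 * ‖z‖ ^ 4 := by
  have h := (hasLaw_inner_stdGaussian z).integral_comp (f := fun x : ℝ ↦ x ^ 4) (by fun_prop)
  simp only [Function.comp_def] at h
  rw [h, integral_pow_four_gaussianReal]
  push_cast
  ring

lemma integrable_inner_pow_stdGaussian (z : E) (k : ℕ) :
    Integrable (fun g : E ↦ ⟪z, g⟫ ^ k) (stdGaussian E) := by
  have := (memLp_inner_stdGaussian z k).integrable_norm_pow'
  refine this.mono' (by fun_prop) (ae_of_all _ fun g ↦ ?_)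
  simp

lemma memLp_two_inner_mul_inner_stdGaussian (z w : E) :
    MemLp (fun g : E ↦ ⟪z, g⟫ * ⟪w, g⟫) 2 (stdGaussian E) := by
  have : ENNReal.HolderTriple ((4 : ℝ≥0) : ENNReal) ((4 : ℝ≥0) : ENNReal) 2 := by
    refine ⟨?_⟩
    rw [← two_mul, show ((4 : ℝ≥0) : ENNReal) = 2 * 2 by norm_num,
      ENNReal.mul_inv (by simp) (by simp), ← mul_assoc, ENNReal.mul_inv_cancel (by simp) (by simp),
      one_mul]
  exact (memLp_inner_stdGaussian w 4).mul' (memLp_inner_stdGaussian z 4)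

lemma integral_inner_mul_inner_stdGaussian (u w : E) :
    ∫ g, ⟪u, g⟫ * ⟪w, g⟫ ∂(stdGaussian E) = ⟪u, w⟫ := by
  have h : (fun g : E ↦ ⟪u, g⟫ * ⟪w, g⟫)
      = fun g ↦ 1 / 4 * ⟪u + w, g⟫ ^ 2 - 1 / 4 * ⟪u - w, g⟫ ^ 2 := by
    ext g
    rw [inner_add_left, inner_sub_left]
    ring
  rw [h, integral_sub ((integrable_inner_pow_stdGaussian _ 2).const_mul _)
    ((integrable_inner_pow_stdGaussian _ 2).const_mul _), integral_const_mul, integral_const_mul,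
    integral_inner_sq_stdGaussian, integral_inner_sq_stdGaussian, norm_add_sq_real,
    norm_sub_sq_real]
  ring

/-- The linearization of the cosine of two sample vectors: `a b - c (a² + b²) / 2`. -/
noncomputable def cosineScore (u w g : E) : ℝ :=
  ⟪u, g⟫ * ⟪w, g⟫ - ⟪u, w⟫ / 2 * (⟪u, g⟫ ^ 2 + ⟪w, g⟫ ^ 2)

@[fun_prop]
lemma measurable_cosineScore (u w : E) : Measurable (cosineScore u w) := by
  unfold cosineScore; fun_prop

lemma memLp_cosineScore (u w : E) : MemLp (cosineScore u w) 2 (stdGaussian E) := by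
  have := (memLp_two_inner_mul_inner_stdGaussian u w).sub
    (((memLp_two_inner_mul_inner_stdGaussian u u).add
      (memLp_two_inner_mul_inner_stdGaussian w w)).const_mul (⟪u, w⟫ / 2))
  convert! this using 1
  ext g
  simp [cosineScore, pow_two]

variable {u w : E}

lemma integral_cosineScore (hu : ‖u‖ = 1) (hw : ‖w‖ = 1) :
    ∫ g, cosineScore u w g ∂(stdGaussian E) = 0 := by
  unfold cosineScore
  have hi : Integrable (fun g ↦ ⟪u, g⟫ ^ 2 + ⟪w, g⟫ ^ 2) (stdGaussian E) :=
    (integrable_inner_pow_stdGaussian u 2).add (integrable_inner_pow_stdGaussian w 2)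
  rw [integral_sub ((memLp_two_inner_mul_inner_stdGaussian u w).integrable (by norm_num))
    (hi.const_mul _), integral_const_mul,
    integral_add (integrable_inner_pow_stdGaussian u 2) (integrable_inner_pow_stdGaussian w 2),
    integral_inner_mul_inner_stdGaussian, integral_inner_sq_stdGaussian,
    integral_inner_sq_stdGaussian, hu, hw]
  ring

lemma variance_cosineScore (hu : ‖u‖ = 1) (hw : ‖w‖ = 1) :
    Var[cosineScore u w; stdGaussian E] = (1 - ⟪u, w⟫ ^ 2) ^ 2 := by
  rw [variance_eq_integral (by fun_prop), integral_cosineScore hu hw]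
  set c := ⟪u, w⟫ with hc
  -- Polarization: the quartic is a combination of fourth powers of linear forms, so one-dimensional
  -- fourth moments suffice. The score is `((1-c)s² - (1+c)d²)/4` with `s, d = ⟪u ± w, g⟫`; the
  -- cross term `s²d²` equals `4/3 (⟪u,g⟫⁴ + ⟪w,g⟫⁴) - (s⁴ + d⁴)/6`.
  have h : (fun g : E ↦ (cosineScore u w g - 0) ^ 2)
      = fun g ↦ ((1 - c) ^ 2 / 16 + (1 - c ^ 2) / 48) * ⟪u + w, g⟫ ^ 4
        + ((1 + c) ^ 2 / 16 + (1 - c ^ 2) / 48) * ⟪u - w, g⟫ ^ 4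
        + (-(1 - c ^ 2) / 6 * ⟪u, g⟫ ^ 4 + -(1 - c ^ 2) / 6 * ⟪w, g⟫ ^ 4) := by
    ext g
    rw [cosineScore, ← hc, inner_add_left, inner_sub_left]
    ring
  have hi (z : E) (r : ℝ) : Integrable (fun g ↦ r * ⟪z, g⟫ ^ 4) (stdGaussian E) :=
    (integrable_inner_pow_stdGaussian z 4).const_mul r
  have hp : ‖u + w‖ ^ 4 = (2 + 2 * c) ^ 2 := by
    rw [show ‖u + w‖ ^ 4 = (‖u + w‖ ^ 2) ^ 2 by ring, norm_add_sq_real, hu, hw]; ring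
  have hm : ‖u - w‖ ^ 4 = (2 - 2 * c) ^ 2 := by
    rw [show ‖u - w‖ ^ 4 = (‖u - w‖ ^ 2) ^ 2 by ring, norm_sub_sq_real, hu, hw]; ring
  have hs (z₁ z₂ : E) (r₁ r₂ : ℝ) :
      Integrable (fun g ↦ r₁ * ⟪z₁, g⟫ ^ 4 + r₂ * ⟪z₂, g⟫ ^ 4) (stdGaussian E) :=
    (hi z₁ r₁).add (hi z₂ r₂)
  rw [h, integral_add (hs _ _ _ _) (hs _ _ _ _),
    integral_add (hi _ _) (hi _ _), integral_add (hi _ _) (hi _ _)]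
  simp only [integral_const_mul, integral_inner_pow_four_stdGaussian, hp, hm, hu, hw]
  ring

end StdGaussian

/-! ### Transfer between probability spaces and Slutsky-type lemmas -/

section Convergence

variable {ι : Type*} {Ω Ω₂ : ι → Type*} {m : ∀ i, MeasurableSpace (Ω i)}
  {m₂ : ∀ i, MeasurableSpace (Ω₂ i)} {μ : ∀ i, Measure (Ω i)} {ν : ∀ i, Measure (Ω₂ i)}
  [∀ i, IsProbabilityMeasure (μ i)] [∀ i, IsProbabilityMeasure (ν i)]
  {Ω' : Type*} {m' : MeasurableSpace Ω'} {μ' : Measure Ω'} [IsProbabilityMeasure μ']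
  {E : Type*} [TopologicalSpace E] [MeasurableSpace E] [OpensMeasurableSpace E]
  {X : ∀ i, Ω i → E} {Y : ∀ i, Ω₂ i → E} {Z : Ω' → E} {l : Filter ι}

/-- Convergence in distribution depends only on the laws of the random variables. -/
lemma MeasureTheory.TendstoInDistribution.congr_identDistrib
    (h : TendstoInDistribution X l Z μ μ')
    (hXY : ∀ i, IdentDistrib (Y i) (X i) (ν i) (μ i)) : TendstoInDistribution Y l Z ν μ' where
  forall_aemeasurable i := (hXY i).aemeasurable_fst
  aemeasurable_limit := h.aemeasurable_limit
  tendsto := by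
    exact h.tendsto.congr fun i ↦ Subtype.ext (hXY i).map_eq.symm

end Convergence

section Slutsky

variable {Ω Ω' : Type*} {m : MeasurableSpace Ω} {m' : MeasurableSpace Ω'} {P : Measure Ω}
  {μ' : Measure Ω'} [IsProbabilityMeasure P] [IsProbabilityMeasure μ']
  {X Y : ℕ → Ω → ℝ} {Z : Ω' → ℝ}

/-- Portmanteau for `{ε ≤ ‖x‖}`: its frontier lies in `{‖x‖ = ε}`, which is null for the point mass
at `0`. -/
lemma MeasureTheory.TendstoInDistribution.tendstoInMeasure_zero
    (h : TendstoInDistribution X atTop (fun _ : Ω' ↦ (0 : ℝ)) (fun _ ↦ P) μ') :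
    TendstoInMeasure P X atTop (fun _ ↦ 0) := by
  rw [tendstoInMeasure_iff_norm]
  intro ε hε
  have hfr : frontier {x : ℝ | ε ≤ ‖x‖} ⊆ {x : ℝ | ε = ‖x‖} :=
    frontier_le_subset_eq continuous_const continuous_norm
  have hlim := ProbabilityMeasure.tendsto_measure_of_null_frontier_of_tendsto' h.tendsto
    (E := {x : ℝ | ε ≤ ‖x‖}) (by
      simp only [ProbabilityMeasure.coe_mk]
      refine measure_mono_null hfr ?_
      rw [Measure.map_const]
      simp [hε.ne'])
  have hms : MeasurableSet {x : ℝ | ε ≤ ‖x‖} := measurableSet_le measurable_const measurable_norm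
  simp only [ProbabilityMeasure.coe_mk] at hlim
  rw [Measure.map_const] at hlim
  simp only [Measure.map_apply_of_aemeasurable (h.forall_aemeasurable _) hms] at hlim
  simpa [hms, hε.not_ge, Set.indicator] using hlim

lemma MeasureTheory.TendstoInDistribution.mul_tendstoInMeasure_zero
    (hX : TendstoInDistribution X atTop Z (fun _ ↦ P) μ')
    (hY : TendstoInMeasure P Y atTop (fun _ ↦ 0)) (hYm : ∀ i, AEMeasurable (Y i) P) :
    TendstoInMeasure P (fun n ω ↦ X n ω * Y n ω) atTop (fun _ ↦ 0) := by
  have h := hX.continuous_comp_prodMk_of_tendstoInMeasure_const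
    (g := fun p : ℝ × ℝ ↦ p.1 * p.2) (by fun_prop) hY hYm
  simp only [mul_zero] at h
  exact h.tendstoInMeasure_zero

end Slutsky

/-- The cosine error as its linearization, times a factor close to `1`, plus a remainder. -/
lemma sqrt_mul_cosine_sub_eq {s a b c A B C : ℝ} (hA : A = a ^ 2) (hB : B = b ^ 2)
    (ha : 0 < a) (hb : 0 < b) :
    s * (C / (a * b) - c) = s * (C - c / 2 * (A + B)) * (a * b)⁻¹
      + s * (A - B) * (c / 2 * (A - B) / ((a + b) ^ 2 * (a * b))) := by
  subst hA hB
  field_simp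
  ring

/-! ### Limit theorem for an i.i.d. Gaussian sequence on one space -/

section FixedSpace

variable {E : Type*} [NormedAddCommGroup E] [InnerProductSpace ℝ E] [FiniteDimensional ℝ E]
  [MeasurableSpace E] {Ω : Type*} {m : MeasurableSpace Ω} {P : Measure Ω}
  {X : ℕ → Ω → E} {u w : E}

/-- The cosine of the vectors `(⟪u, X k⟫)_{k < q}` and `(⟪w, X k⟫)_{k < q}`. -/
noncomputable def sampleCosine (X : ℕ → Ω → E) (u w : E) (q : ℕ) (ω : Ω) : ℝ :=
  (∑ k ∈ Finset.range q, ⟪u, X k ω⟫ * ⟪w, X k ω⟫) /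
    (√(∑ k ∈ Finset.range q, ⟪u, X k ω⟫ ^ 2) * √(∑ k ∈ Finset.range q, ⟪w, X k ω⟫ ^ 2))

lemma ae_tendsto_average_stdGaussian (hX : ∀ k, HasLaw (X k) (stdGaussian E) P)
    (hind : iIndepFun X P) {f : E → ℝ} (hf : Measurable f) (hfi : Integrable f (stdGaussian E)) :
    ∀ᵐ ω ∂P, Tendsto (fun q : ℕ ↦ (∑ k ∈ Finset.range q, f (X k ω)) / q) atTop
      (𝓝 (∫ g, f g ∂(stdGaussian E))) := by
  have h := strong_law_ae_real (μ := P) (fun k ↦ f ∘ X k)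
    (((hX 0).map_eq.symm ▸ hfi : Integrable f (P.map (X 0))).comp_aemeasurable (hX 0).aemeasurable)
    (fun i j hij ↦ (hind.indepFun hij).comp hf hf)
    (fun i ↦ ((hX i).identDistrib (hX 0)).comp hf)
  rwa [(hX 0).integral_comp hf.aestronglyMeasurable] at h

variable [IsProbabilityMeasure P]

lemma tendstoInDistribution_sum_stdGaussian (hX : ∀ k, HasLaw (X k) (stdGaussian E) P)
    (hind : iIndepFun X P) {f : E → ℝ} (hf : Measurable f) (hfi : MemLp f 2 (stdGaussian E))
    (hf0 : ∫ g, f g ∂(stdGaussian E) = 0) :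
    TendstoInDistribution (fun (q : ℕ) ω ↦ (√(q : ℝ))⁻¹ * ∑ k ∈ Finset.range q, f (X k ω)) atTop
      (id : ℝ → ℝ) (fun _ ↦ P) (gaussianReal 0 (Var[f; stdGaussian E]).toNNReal) := by
  have hvar : Var[f ∘ X 0; P] = Var[f; stdGaussian E] := by
    rw [← (hX 0).map_eq, variance_map hf.aemeasurable (hX 0).aemeasurable]
  have hmean : P[f ∘ X 0] = 0 := by
    rw [(hX 0).integral_comp hf.aestronglyMeasurable, hf0]
  have h := tendstoInDistribution_inv_sqrt_mul_sum_sub (X := fun k ↦ f ∘ X k) (P := P)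
    (P' := gaussianReal 0 (Var[f; stdGaussian E]).toNNReal) (Y := id)
    (by rw [hvar]; exact HasLaw.id)
    (((hX 0).map_eq.symm ▸ hfi : MemLp f 2 (P.map (X 0))).comp_of_map (hX 0).aemeasurable)
    (hind.comp (fun _ ↦ f) fun _ ↦ hf)
    (fun i ↦ ((hX i).identDistrib (hX 0)).comp hf)
  rw [hmean] at h
  simpa using h

variable [BorelSpace E]

theorem tendstoInDistribution_sqrt_mul_sampleCosine_sub (hX : ∀ k, HasLaw (X k) (stdGaussian E) P)
    (hind : iIndepFun X P) (hu : ‖u‖ = 1) (hw : ‖w‖ = 1) :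
    TendstoInDistribution (fun (q : ℕ) ω ↦ √(q : ℝ) * (sampleCosine X u w q ω - ⟪u, w⟫)) atTop
      (id : ℝ → ℝ) (fun _ ↦ P) (gaussianReal 0 (((1 - ⟪u, w⟫ ^ 2) ^ 2).toNNReal)) := by
  have hXm (k : ℕ) : AEMeasurable (X k) P := (hX k).aemeasurable
  set c := ⟪u, w⟫ with hc
  let A (q : ℕ) (ω : Ω) : ℝ := (∑ k ∈ Finset.range q, ⟪u, X k ω⟫ ^ 2) / q
  let B (q : ℕ) (ω : Ω) : ℝ := (∑ k ∈ Finset.range q, ⟪w, X k ω⟫ ^ 2) / q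
  have hAm (q : ℕ) : AEMeasurable (A q) P := by fun_prop
  have hBm (q : ℕ) : AEMeasurable (B q) P := by fun_prop
  let W (q : ℕ) (ω : Ω) : ℝ := (√(q : ℝ))⁻¹ * ∑ k ∈ Finset.range q, cosineScore u w (X k ω)
  let V (q : ℕ) (ω : Ω) : ℝ := (√(q : ℝ))⁻¹ *
    ∑ k ∈ Finset.range q, (⟪u, X k ω⟫ ^ 2 - ⟪w, X k ω⟫ ^ 2)
  let S (q : ℕ) (ω : Ω) : ℝ := (√(A q ω) * √(B q ω))⁻¹
  let T (q : ℕ) (ω : Ω) : ℝ := c / 2 * (A q ω - B q ω) /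
    ((√(A q ω) + √(B q ω)) ^ 2 * (√(A q ω) * √(B q ω)))
  let Y (q : ℕ) (ω : Ω) : ℝ := √(q : ℝ) * (sampleCosine X u w q ω - c)
  have hA : ∀ᵐ ω ∂P, Tendsto (fun q ↦ A q ω) atTop (𝓝 1) := by
    have := ae_tendsto_average_stdGaussian hX hind (f := fun g ↦ ⟪u, g⟫ ^ 2) (by fun_prop)
      (integrable_inner_pow_stdGaussian u 2)
    simpa [integral_inner_sq_stdGaussian, hu] using this
  have hB : ∀ᵐ ω ∂P, Tendsto (fun q ↦ B q ω) atTop (𝓝 1) := by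
    have := ae_tendsto_average_stdGaussian hX hind (f := fun g ↦ ⟪w, g⟫ ^ 2) (by fun_prop)
      (integrable_inner_pow_stdGaussian w 2)
    simpa [integral_inner_sq_stdGaussian, hw] using this
  have hWd := tendstoInDistribution_sum_stdGaussian hX hind (measurable_cosineScore u w)
    (memLp_cosineScore u w) (integral_cosineScore hu hw)
  rw [variance_cosineScore hu hw, ← hc] at hWd
  have hVd := tendstoInDistribution_sum_stdGaussian hX hind
    (f := fun g ↦ ⟪u, g⟫ ^ 2 - ⟪w, g⟫ ^ 2) (by fun_prop)
    (by
      have := (memLp_two_inner_mul_inner_stdGaussian u u).sub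
        (memLp_two_inner_mul_inner_stdGaussian w w)
      simp only [← pow_two] at this
      exact this)
    (by
      rw [integral_sub (integrable_inner_pow_stdGaussian u 2)
        (integrable_inner_pow_stdGaussian w 2), integral_inner_sq_stdGaussian,
        integral_inner_sq_stdGaussian, hu, hw, sub_self])
  have hSm (q : ℕ) : AEMeasurable (S q) P := by fun_prop
  have hTm (q : ℕ) : AEMeasurable (T q) P := by fun_prop
  have hYm (q : ℕ) : AEMeasurable (Y q) P := by
    simp only [Y, sampleCosine]
    fun_prop
  have hS : TendstoInMeasure P S atTop fun _ ↦ 1 := by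
    refine tendstoInMeasure_of_tendsto_ae (fun q ↦ (hSm q).aestronglyMeasurable) ?_
    filter_upwards [hA, hB] with ω h1 h2
    simpa [S] using (h1.sqrt.mul h2.sqrt).inv₀ (by simp)
  have hT : TendstoInMeasure P T atTop fun _ ↦ 0 := by
    refine tendstoInMeasure_of_tendsto_ae (fun q ↦ (hTm q).aestronglyMeasurable) ?_
    filter_upwards [hA, hB] with ω h1 h2
    have := ((h1.sub h2).const_mul (c / 2)).div
      (((h1.sqrt.add h2.sqrt).pow 2).mul (h1.sqrt.mul h2.sqrt)) (by norm_num)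
    simp only [sub_self, mul_zero, zero_div] at this
    exact this
  -- The remainder `√q (A - B)²` is split so that `V` carries one factor `√q (A - B)`, which
  -- converges in law, while `T` keeps the other, which vanishes.
  have hVT : TendstoInMeasure P (fun q ω ↦ V q ω * T q ω) atTop fun _ ↦ 0 :=
    hVd.mul_tendstoInMeasure_zero hT hTm
  have hVTm (q : ℕ) : AEMeasurable (fun ω ↦ V q ω * T q ω) P :=
    (hVd.forall_aemeasurable q).mul (hTm q)
  have hWS : TendstoInDistribution (fun q ω ↦ W q ω * S q ω) atTop (id : ℝ → ℝ) (fun _ ↦ P)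
      (gaussianReal 0 (((1 - c ^ 2) ^ 2).toNNReal)) := by
    have := hWd.continuous_comp_prodMk_of_tendstoInMeasure_const
      (g := fun p : ℝ × ℝ ↦ p.1 * p.2) (by fun_prop) hS hSm
    simp only [mul_one] at this
    exact this
  have hmain : TendstoInDistribution (fun q ω ↦ W q ω * S q ω + V q ω * T q ω) atTop
      (id : ℝ → ℝ) (fun _ ↦ P) (gaussianReal 0 (((1 - c ^ 2) ^ 2).toNNReal)) := by
    have := hWS.add_of_tendstoInMeasure_const hVT hVTm
    simp only [add_zero] at this
    exact this
  -- The decomposition needs `A, B > 0`. Almost surely this holds for all large `q`, so the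
  -- difference is eventually `0`.
  refine tendstoInDistribution_of_tendstoInMeasure_sub Y id hmain ?_ hYm
  refine tendstoInMeasure_of_tendsto_ae (fun q ↦ ((hYm q).sub
    (hmain.forall_aemeasurable q)).aestronglyMeasurable) ?_
  filter_upwards [hA, hB] with ω h1 h2
  refine tendsto_const_nhds.congr' ?_
  filter_upwards [h1.eventually_const_lt one_pos, h2.eventually_const_lt one_pos,
    eventually_gt_atTop 0] with q hq1 hq2 hq
  have hq0 : (0 : ℝ) < q := by exact_mod_cast hq
  have hcos : sampleCosine X u w q ω = ((∑ k ∈ Finset.range q, ⟪u, X k ω⟫ * ⟪w, X k ω⟫) / q) /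
      (√(A q ω) * √(B q ω)) := by
    simp only [sampleCosine, A, B]
    rw [Real.sqrt_div' _ hq0.le, Real.sqrt_div' _ hq0.le, div_mul_div_comm,
      Real.mul_self_sqrt hq0.le, div_div_div_cancel_right₀ hq0.ne']
  have hsq : (√(q : ℝ))⁻¹ = √(q : ℝ) / q := by
    rw [Real.sqrt_div_self', one_div]
  have hdec := sqrt_mul_cosine_sub_eq (s := √(q : ℝ)) (c := c)
    (C := (∑ k ∈ Finset.range q, ⟪u, X k ω⟫ * ⟪w, X k ω⟫) / q)
    (Real.sq_sqrt hq1.le).symm (Real.sq_sqrt hq2.le).symm (Real.sqrt_pos.2 hq1)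
    (Real.sqrt_pos.2 hq2)
  have hW : W q ω = √(q : ℝ) * ((∑ k ∈ Finset.range q, ⟪u, X k ω⟫ * ⟪w, X k ω⟫) / q -
      c / 2 * (A q ω + B q ω)) := by
    simp only [W, A, B, cosineScore, ← hc, Finset.sum_sub_distrib, ← Finset.mul_sum,
      Finset.sum_add_distrib, hsq]
    ring
  have hV : V q ω = √(q : ℝ) * (A q ω - B q ω) := by
    simp only [V, A, B, Finset.sum_sub_distrib, hsq]
    ring
  simp only [Pi.zero_apply, Pi.sub_apply, Y, S, T, hW, hV, hcos, hdec, sub_self]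

end FixedSpace

/-! ### Reduction of random projections to the Gaussian sequence -/

lemma cosineSimilarity_smul_smul {m : ℕ} (x y : EuclideanSpace ℝ (Fin m)) {r s : ℝ}
    (hr : 0 < r) (hs : 0 < s) : cosineSimilarity (r • x) (s • y) = cosineSimilarity x y := by
  unfold cosineSimilarity
  rw [real_inner_smul_left, real_inner_smul_right, norm_smul, norm_smul, Real.norm_of_nonneg hr.le,
    Real.norm_of_nonneg hs.le, ← mul_assoc, mul_mul_mul_comm,
    mul_div_mul_left _ _ (mul_pos hr hs).ne']

lemma cosineSimilarity_toLp_inner {n : ℕ} {Ω : Type*} (X : ℕ → Ω → EuclideanSpace ℝ (Fin n))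
    (u w : EuclideanSpace ℝ (Fin n)) (q : ℕ) (ω : Ω) :
    cosineSimilarity (WithLp.toLp 2 fun i : Fin q ↦ ⟪u, X i ω⟫)
      (WithLp.toLp 2 fun i : Fin q ↦ ⟪w, X i ω⟫) = sampleCosine X u w q ω := by
  simp [cosineSimilarity, sampleCosine, EuclideanSpace.norm_eq, PiLp.inner_apply,
    Finset.sum_range, mul_comm]

lemma projectVector_smul {q n : ℕ} (a : ℝ) (g : Fin q → EuclideanSpace ℝ (Fin n))
    {x : EuclideanSpace ℝ (Fin n)} (hx : x ≠ 0) :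
    projectVector (Matrix.of fun i j ↦ a * g i j) x
      = (a * ‖x‖) • WithLp.toLp 2 fun i : Fin q ↦ ⟪‖x‖⁻¹ • x, g i⟫ := by
  ext i
  have : ‖x‖ ≠ 0 := norm_ne_zero_iff.2 hx
  simp only [projectVector, Matrix.mulVec, dotProduct, Matrix.of_apply, PiLp.smul_apply,
    smul_eq_mul, real_inner_smul_left]
  rw [mul_assoc, mul_inv_cancel_left₀ this, PiLp.inner_apply, Finset.mul_sum]
  simp [mul_assoc]

lemma measurable_cosineSimilarity_projectVector {q n : ℕ} (x y : EuclideanSpace ℝ (Fin n)) :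
    Measurable fun v : Fin q × Fin n → ℝ ↦
      cosineSimilarity (projectVector (Matrix.of fun i j ↦ v (i, j)) x)
        (projectVector (Matrix.of fun i j ↦ v (i, j)) y) := by
  simp only [cosineSimilarity, projectVector, EuclideanSpace.norm_eq, PiLp.inner_apply,
    Matrix.mulVec, dotProduct, Matrix.of_apply]
  simp only [RCLike.inner_apply, Real.ringHom_apply, Real.norm_eq_abs]
  fun_prop

/-- Independence and the marginals fix the joint law, so any two random projections of the same size
are identically distributed. -/
lemma IsRandomProjection.hasLaw_pi {Ω : Type*} [MeasurableSpace Ω] {q n : ℕ}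
    {R : Ω → Matrix (Fin q) (Fin n) ℝ} {μ : Measure Ω} [IsProbabilityMeasure μ]
    (hR : IsRandomProjection R μ) :
    HasLaw (fun ω (p : Fin q × Fin n) ↦ R ω p.1 p.2)
      (Measure.pi fun _ ↦ gaussianReal 0 (1 / (q : ℝ≥0))) μ :=
  hR.iIndepFun_entry.hasLaw_pi fun p ↦ hR.hasLaw_entry p.1 p.2

/-- Rescaling the first `q` terms of an i.i.d. sequence of standard Gaussian vectors yields a random
projection matrix. -/
lemma isRandomProjection_of_rows {n : ℕ} {Ω : Type*} [MeasurableSpace Ω] {P : Measure Ω}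
    [IsProbabilityMeasure P] {G : ℕ → Ω → Fin n → ℝ} (hGm : ∀ k, Measurable (G k))
    (hG : ∀ k, HasLaw (G k) (Measure.pi fun _ ↦ gaussianReal 0 1) P) (hind : iIndepFun G P)
    (q : ℕ) :
    IsRandomProjection (fun ω ↦ Matrix.of fun (i : Fin q) j ↦ (√(q : ℝ))⁻¹ * G i ω j) P := by
  have hentry (k : ℕ) (j : Fin n) : HasLaw (fun ω ↦ G k ω j) (gaussianReal 0 1) P :=
    (measurePreserving_eval (fun _ : Fin n ↦ gaussianReal 0 1) j).hasLaw.comp (hG k)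
  have hrow (k : ℕ) : iIndepFun (fun j ω ↦ G k ω j) P :=
    (iIndepFun_iff_hasLaw_pi_pi (hentry k)).2 (hG k)
  have hall := iIndepFun_uncurry' (X := fun k j ω ↦ G k ω j) (P := P) (by fun_prop) hind hrow
  have hinj : Function.Injective fun p : Fin q × Fin n ↦ ((p.1 : ℕ), p.2) :=
    fun p p' h ↦ by simpa [Prod.ext_iff, Fin.ext_iff] using h
  refine ⟨fun i j ↦ ?_, (hall.precomp hinj).comp (fun _ t ↦ (√(q : ℝ))⁻¹ * t) (by fun_prop)⟩
  convert! gaussianReal_const_mul (hentry i j) (√(q : ℝ))⁻¹ using 2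
  · simp
  · ext
    simp

theorem mainTheorem8 {n : ℕ} {Ω : ℕ → Type*} [∀ q, MeasurableSpace (Ω q)]
    (μ : ∀ q, Measure (Ω q)) [∀ q, IsProbabilityMeasure (μ q)]
    (R : ∀ q, Ω q → Matrix (Fin q) (Fin n) ℝ)
    (hR : ∀ q, IsRandomProjection (R q) (μ q))
    (x y : EuclideanSpace ℝ (Fin n)) (hx : x ≠ 0) (hy : y ≠ 0) :
    TendstoInDistribution
      (fun (q : ℕ) (ω : Ω q) =>
        √(q : ℝ) * (cosineSimilarity (projectVector (R q ω) x) (projectVector (R q ω) y)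
          - cosineSimilarity x y))
      atTop (id : ℝ → ℝ) μ
      (gaussianReal 0 (Real.toNNReal ((1 - cosineSimilarity x y ^ 2) ^ 2))) := by
  obtain ⟨Ω₀, _, P, G, hGm, hG, hind, _⟩ :=
    exists_iid ℕ (Measure.pi fun _ : Fin n ↦ gaussianReal 0 1)
  let X (k : ℕ) (ω : Ω₀) : EuclideanSpace ℝ (Fin n) := WithLp.toLp 2 (G k ω)
  have hX (k : ℕ) : HasLaw (X k) (stdGaussian (EuclideanSpace ℝ (Fin n))) P :=
    HasLaw.comp ⟨by fun_prop, map_pi_eq_stdGaussian⟩ (hG k)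
  have hXind : iIndepFun X P := hind.comp (fun _ ↦ WithLp.toLp 2) (by fun_prop)
  have hx0 : 0 < ‖x‖ := norm_pos_iff.2 hx
  have hy0 : 0 < ‖y‖ := norm_pos_iff.2 hy
  have hunit {z : EuclideanSpace ℝ (Fin n)} (hz : 0 < ‖z‖) : ‖‖z‖⁻¹ • z‖ = 1 := by
    rw [norm_smul, norm_inv, norm_norm, inv_mul_cancel₀ hz.ne']
  have hc : ⟪‖x‖⁻¹ • x, ‖y‖⁻¹ • y⟫ = cosineSimilarity x y := by
    rw [← cosineSimilarity_smul_smul x y (inv_pos.2 hx0) (inv_pos.2 hy0), cosineSimilarity,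
      hunit hx0, hunit hy0, mul_one, div_one]
  have hlim := tendstoInDistribution_sqrt_mul_sampleCosine_sub hX hXind (hunit hx0) (hunit hy0)
  rw [hc] at hlim
  refine hlim.congr_identDistrib fun q ↦ ?_
  have hid := ((hR q).hasLaw_pi.identDistrib (isRandomProjection_of_rows hGm hG hind q).hasLaw_pi)
  have hstat := hid.comp (((measurable_cosineSimilarity_projectVector x y).sub_const
    (cosineSimilarity x y)).const_mul √(q : ℝ))
  convert! hstat using 1
  ext ω
  -- At `q = 0` the scale `(√q)⁻¹` is `0`, so scale invariance fails, but the factor `√q` kills both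
  -- sides.
  obtain rfl | hq := q.eq_zero_or_pos
  · simp
  have hs : 0 < (√(q : ℝ))⁻¹ := by positivity
  have hG' (z : EuclideanSpace ℝ (Fin n)) (hz : z ≠ 0) :=
    projectVector_smul (√(q : ℝ))⁻¹ (fun i : Fin q ↦ X i ω) hz
  simp only [Function.comp_apply, Matrix.of_apply]
  rw [← cosineSimilarity_toLp_inner, ← cosineSimilarity_smul_smul _ _ (mul_pos hs hx0)
    (mul_pos hs hy0), ← hG' x hx, ← hG' y hy]
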